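/- **Conventions.** Formulas are first-order formulas over $\neg,\wedge,\vee,\to$, with equality, unbounded quantifiers $\forall v,\exists v$ and bounded quantifiers $\forall v\le t,\exists v\le t$ ($t$ a term not containing $v$). Truth means truth in the standard model $\mathbb N$, and $\mathrm{Log}$ is the base-2 logarithm, with the convention $\mathrm{Log}(0)=0$. A deduction method $d$ comes with an injective Gödel numbering $\lceil\cdot\rceil$ of formulas and a relation "$p$ is (the Gödel number of) a proof of $\phi$ from $\alpha$". It is arbitrary unless properties are stated. **Generic configurations.** A generic configuration $\xi=(L^\xi,\Delta_0^\xi,B^\xi,d,g)$ ($g$ being the Gödel numbering) consists of the following. 1. A language $L^\xi$ with standard model $\mathbb N$, having symbols for $0,1,2,=,\le,\mathrm{Max}$ with their usual meaning and for each $k\in\mathbb N$ a closed term $\bar k$ with value $k$. 2. A class $\Delta_0^\xi$ of formulas, all of whose quantifiers are bounded. It is closed under the connectives, under substituting variables and numerals $\bar k$ for variables, and under quantification bounded by a variable, and it contains formulas expressing the graphs of addition and of multiplication. Put $\Pi_0^\xi=\Sigma_0^\xi=\Delta_0^\xi$. A $\Pi_{k+1}^\xi$ (respectively $\Sigma_{k+1}^\xi$)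 formula is a possibly empty block of unbounded universal (respectively existential) quantifiers followed by a $\Sigma_k^\xi$ (respectively $\Pi_k^\xi$) formula. The negation of a $\Pi_k^\xi$ sentence is written in prenex form by dualizing the unbounded quantifiers and negating the matrix. 3. A set $B^\xi$ of true sentences ("base axiom system") from which $d$ proves every true $\Sigma_1^\xi$ sentence. 4. A deduction method $d$ which proves $\phi$ from $\alpha$ if and only if $\phi$ is a logical consequence of $\alpha$. 5. A conventional Gödel numbering: a proof stays a proof when an axiom is added; if $p$ is a proof from $\alpha\cup\{\psi\}$ but not from $\alpha$, then $\lceil\psi\rceil\le p$; and the relations $\mathrm{Neg}^k(x,y)$ for every $k$, $\mathrm{Subst}(g,h)$ and, for every finite set $F$ of sentences, $\mathrm{ExPrf}_{F\cup B^\xi}(h,t,p)$, all defined below, belong to the linear-time hierarchy, i.e. to the class generated from the graphs of $+$ and $\times$ by Boolean operations, explicit transformations of variables (including insertion of constants), and quantification bounded by a variable. Here $\mathrm{Neg}^k(x,y)$ says that $x$ is the number of a $\Pi_k^\xi$ sentence and $y$ that of its prenex negation. $\mathrm{Subst}(g,h)$ says that $g$ is the number of a formula and $h$ that of the sentence obtained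 by replacing its free variables with $\bar g$. $\mathrm{Prf}_\alpha(t,p)$ says that $p$ is a proof from $\alpha$ of the sentence with number $t$. $\mathrm{ExPrf}_\alpha(h,t,p)$ says that $p$ is a proof of the sentence with number $t$ from $\alpha$ together with the sentence with number $h$. **Stability.** For a $\Pi_1^\xi$ or $\Sigma_1^\xi$ sentence $\Upsilon$ and $N\in[-\infty,\infty]$, $\Upsilon$ is $\mathrm{Good}(N)$ if it is true after its unbounded quantifiers are restricted to numbers $<2^N$. For a recursively enumerable set $\theta$ of (true or false) $\Pi_1^\xi$ sentences, $\sharp(\theta)$ is the largest integer $J\ge 0$ such that all members of $\theta$ are $\mathrm{Good}(J)$ ($\infty$ if all $J$ qualify, $-\infty$ if none does). Then $\xi$ is * *A-stable* if, for each such $\theta$, every $\Pi_1^\xi$ theorem of $\theta\cup B^\xi$ having a proof $p$ with $\mathrm{Log}(p)\le\sharp(\theta)+1$ is $\mathrm{Good}(\frac12\sharp(\theta))$; * *E-stable* if, for each such $\theta$, every $\Sigma_1^\xi$ theorem of $\theta\cup B^\xi$ having a proof $p$ with $\mathrm{Log}(p)\le\sharp(\theta)+1$ is $\mathrm{Good}(\frac12\lfloor\mathrm{Log}(p)\rfloor-1)$;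 * *EA-stable* if it is both A-stable and E-stable; * *0-stable* if, for each such $\theta$, every $\Delta_0^\xi$ sentence having a proof $p$ from $\theta\cup B^\xi$ with $\mathrm{Log}(p)\le\sharp(\theta)+1$ is true. **Consistency.** $\alpha$ is *$\mathrm{Level}(k^\xi)$ consistent* if there is no $\Pi_k^\xi$ sentence such that $d$ proves both it and its prenex negation from $\alpha$. Given $\beta$ and $k$, let $\Delta_0^\xi$ formulas expressing $\mathrm{Neg}^k$, $\mathrm{Prf}_\beta$, $\mathrm{Subst}$, $\mathrm{ExPrf}_\beta$ in the standard model be chosen, and put $$\mathrm{SubstPrf}_\beta(g,t,p):\quad \mathrm{Prf}_\beta(t,p)\ \vee\ \exists h\le p\,\big(\mathrm{Subst}(g,h)\wedge\mathrm{ExPrf}_\beta(h,t,p)\big),$$ $$\Gamma^k(g):\quad \forall x\,\forall y\,\forall p\,\forall q\ \neg\big(\mathrm{Neg}^k(x,y)\wedge\mathrm{SubstPrf}_\beta(g,x,p)\wedge\mathrm{SubstPrf}_\beta(g,y,q)\big).$$ $\mathrm{SelfCons}^k(\beta,d)$ is the sentence $\Gamma^k(\bar n)$ with $n=\lceil\Gamma^k(g)\rceil$;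 it declares the $\mathrm{Level}(k^\xi)$ consistency of $\beta\cup\{\mathrm{SelfCons}^k(\beta,d)\}$. A *finitized extension* of $B^\xi$ is a set of sentences obtained from $B^\xi$ by adding finitely many sentences. **Global simulation.** Let $\mathcal B$ be a recursively enumerable axiom system in a language extending $L^\xi$, and $D$ any deduction method for that language, possibly different from $d$. Let $\mathrm{Prf}^D_{\mathcal B}(t,q)$ and $\mathrm{Check}^\xi(t)$ be $\Delta_0^\xi$ formulas such that, in the standard model, for every $L^\xi$ sentence $\phi$, $\mathrm{Prf}^D_{\mathcal B}(\lceil\phi\rceil,q)$ says that $q$ is a $D$-proof of $\phi$ from $\mathcal B$, and $\mathrm{Check}^\xi(t)$ says that $t$ is the number of a $\Pi_1^\xi$ sentence. Let $\mathrm{Test}^\xi_0,\mathrm{Test}^\xi_1,\dots$ be a list of all $\Delta_0^\xi$ formulas $\mathrm{Test}(t,x)$ such that $\Psi\leftrightarrow\forall x\,\mathrm{Test}(\lceil\Psi\rceil,x)$ is true for every $\Pi_1^\xi$ sentence $\Psi$. Let $\mathrm{GlobSim}^D_{\mathcal B}(\xi,j)$ be the sentence $$\forall t\,\forall q\,\forall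 x\ \big((\mathrm{Prf}^D_{\mathcal B}(t,q)\wedge\mathrm{Check}^\xi(t))\to\mathrm{Test}^\xi_j(t,x)\big).$$ **Theorem.** In this situation, suppose that all $\Pi_1^\xi$ theorems of $(\mathcal B,D)$ are true. For an index $j$ put $G_j=\mathrm{GlobSim}^D_{\mathcal B}(\xi,j)$. 1. If $\xi$ is EA-stable, then for each $j$ there is a finitized extension $\beta_j$ of $B^\xi$ which contains $G_j$ and recognizes its $\mathrm{Level}(1^\xi)$ self-consistency. That is: $\Delta_0^\xi$ formulas expressing the four relations for $k=1$ and $\beta=B^\xi\cup\{G_j\}$ exist, and for every choice of them the system $\beta_j=B^\xi\cup\{G_j\}\cup\{\mathrm{SelfCons}^1(B^\xi\cup\{G_j\},d)\}$ is a finitized extension of $B^\xi$, contains $G_j$, proves via $d$ its axiom $\mathrm{SelfCons}^1(B^\xi\cup\{G_j\},d)$ declaring its own $\mathrm{Level}(1^\xi)$ consistency, and is in fact consistent and $\mathrm{Level}(1^\xi)$ consistent. 2. If $\xi$ is E-stable, A-stable or 0-stable, then for each $j$ the same holds with $1$ replaced by $0$: there is a finitized extension $\beta_j$ of $B^\xi$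 which contains $G_j$ and recognizes its $\mathrm{Level}(0^\xi)$ self-consistency, and which is in fact consistent and $\mathrm{Level}(0^\xi)$ consistent. -/

import Mathlib

open scoped FirstOrder
open FirstOrder.Language

/-! ### Arithmetical formulas with bounded quantifiers as primitives -/

/-- First-order formulas of `L` whose free variables are `0, …, n - 1`.  A quantifier acting on a
formula with variables `0, …, n` binds variable `n`.  Besides the unbounded quantifiers `∀ v`, `∃ v`
there are the bounded quantifiers `∀ v ≤ t`, `∃ v ≤ t`, where the term `t` does not contain `v`. -/
inductive Fml (L : FirstOrder.Language.{0, 0}) : ℕ → Type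
  | eq {n : ℕ} (s t : L.Term (Fin n)) : Fml L n
  | rel {n l : ℕ} (R : L.Relations l) (ts : Fin l → L.Term (Fin n)) : Fml L n
  | not {n : ℕ} (φ : Fml L n) : Fml L n
  | and {n : ℕ} (φ ψ : Fml L n) : Fml L n
  | or {n : ℕ} (φ ψ : Fml L n) : Fml L n
  | imp {n : ℕ} (φ ψ : Fml L n) : Fml L n
  | all {n : ℕ} (φ : Fml L (n + 1)) : Fml L n
  | ex {n : ℕ} (φ : Fml L (n + 1)) : Fml L n
  | ball {n : ℕ} (t : L.Term (Fin n)) (φ : Fml L (n + 1)) : Fml L n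
  | bex {n : ℕ} (t : L.Term (Fin n)) (φ : Fml L (n + 1)) : Fml L n

namespace Fml

variable {L : FirstOrder.Language.{0, 0}}

/-- Tarski's truth definition. -/
def Realize [L.IsOrdered] {M : Type} [L.Structure M] : {n : ℕ} → Fml L n → (Fin n → M) → Prop
  | _, eq s t, v => s.realize v = t.realize v
  | _, rel R ts, v => Structure.RelMap R fun i => (ts i).realize v
  | _, not φ, v => ¬ φ.Realize v
  | _, and φ ψ, v => φ.Realize v ∧ ψ.Realize v
  | _, or φ ψ, v => φ.Realize v ∨ ψ.Realize v
  | _, imp φ ψ, v => φ.Realize v → ψ.Realize v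
  | _, all φ, v => ∀ a : M, φ.Realize (Fin.snoc v a : Fin (_ + 1) → M)
  | _, ex φ, v => ∃ a : M, φ.Realize (Fin.snoc v a : Fin (_ + 1) → M)
  | _, ball t φ, v => ∀ a : M, Structure.RelMap (leSymb : L.Relations 2) ![a, t.realize v] →
      φ.Realize (Fin.snoc v a : Fin (_ + 1) → M)
  | _, bex t φ, v => ∃ a : M, Structure.RelMap (leSymb : L.Relations 2) ![a, t.realize v] ∧
      φ.Realize (Fin.snoc v a : Fin (_ + 1) → M)

/-- A substitution of terms for variables, pushed under one quantifier. -/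
def lift {n m : ℕ} (σ : Fin n → L.Term (Fin m)) : Fin (n + 1) → L.Term (Fin (m + 1)) :=
  Fin.snoc (fun i => (σ i).relabel Fin.castSucc) (Term.var (Fin.last m))

/-- Simultaneous capture-free substitution of the terms `σ i` for the free variables `i`. -/
def subst : {n m : ℕ} → Fml L n → (Fin n → L.Term (Fin m)) → Fml L m
  | _, _, eq s t, σ => eq (s.subst σ) (t.subst σ)
  | _, _, rel R ts, σ => rel R fun i => (ts i).subst σ
  | _, _, not φ, σ => not (φ.subst σ)
  | _, _, and φ ψ, σ => and (φ.subst σ) (ψ.subst σ)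
  | _, _, or φ ψ, σ => or (φ.subst σ) (ψ.subst σ)
  | _, _, imp φ ψ, σ => imp (φ.subst σ) (ψ.subst σ)
  | _, _, all φ, σ => all (φ.subst (lift σ))
  | _, _, ex φ, σ => ex (φ.subst (lift σ))
  | _, _, ball t φ, σ => ball (t.subst σ) (φ.subst (lift σ))
  | _, _, bex t φ, σ => bex (t.subst σ) (φ.subst (lift σ))

/-- Renaming of the free variables. -/
def rename {n m : ℕ} (φ : Fml L n) (f : Fin n → Fin m) : Fml L m :=
  φ.subst fun i => Term.var (f i)

/-- Translation of a formula along an inclusion of languages. -/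
def onLHom {L' : FirstOrder.Language.{0, 0}} (ι : L →ᴸ L') : {n : ℕ} → Fml L n → Fml L' n
  | _, eq s t => eq (ι.onTerm s) (ι.onTerm t)
  | _, rel R ts => rel (ι.onRelation R) fun i => ι.onTerm (ts i)
  | _, not φ => not (φ.onLHom ι)
  | _, and φ ψ => and (φ.onLHom ι) (ψ.onLHom ι)
  | _, or φ ψ => or (φ.onLHom ι) (ψ.onLHom ι)
  | _, imp φ ψ => imp (φ.onLHom ι) (ψ.onLHom ι)
  | _, all φ => all (φ.onLHom ι)
  | _, ex φ => ex (φ.onLHom ι)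
  | _, ball t φ => ball (ι.onTerm t) (φ.onLHom ι)
  | _, bex t φ => bex (ι.onTerm t) (φ.onLHom ι)

/-- All quantifiers are bounded. -/
def FullyBounded : {n : ℕ} → Fml L n → Prop
  | _, eq _ _ => True
  | _, rel _ _ => True
  | _, not φ => φ.FullyBounded
  | _, and φ ψ => φ.FullyBounded ∧ ψ.FullyBounded
  | _, or φ ψ => φ.FullyBounded ∧ ψ.FullyBounded
  | _, imp φ ψ => φ.FullyBounded ∧ ψ.FullyBounded
  | _, all _ => False
  | _, ex _ => False
  | _, ball _ φ => φ.FullyBounded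
  | _, bex _ φ => φ.FullyBounded

/-- The negation of a prenex formula, again in prenex form: the unbounded quantifiers of the prefix
are dualized, and the matrix is negated. -/
def prenexNeg : {n : ℕ} → Fml L n → Fml L n
  | _, all φ => ex φ.prenexNeg
  | _, ex φ => all φ.prenexNeg
  | _, φ => not φ

end Fml

/-- `2 ^ N` for an extended real number `N`. -/
noncomputable def twoPow (N : EReal) : EReal :=
  if N = ⊤ then ⊤ else if N = ⊥ then 0 else (((2 : ℝ) ^ N.toReal : ℝ) : EReal)

/-- Truth, among the natural numbers, of the prenex formula obtained by replacing each unbounded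
quantifier `∀ v`, `∃ v` of the prefix by `∀ v < 2 ^ N`, `∃ v < 2 ^ N`. -/
def Fml.RealizeScope {L : FirstOrder.Language.{0, 0}} [L.IsOrdered] [L.Structure ℕ] (N : EReal) :
    {n : ℕ} → Fml L n → (Fin n → ℕ) → Prop
  | _, .all φ, v => ∀ a : ℕ, ((a : ℝ) : EReal) < twoPow N →
      φ.RealizeScope N (Fin.snoc v a : Fin (_ + 1) → ℕ)
  | _, .ex φ, v => ∃ a : ℕ, ((a : ℝ) : EReal) < twoPow N ∧
      φ.RealizeScope N (Fin.snoc v a : Fin (_ + 1) → ℕ)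
  | _, φ, v => φ.Realize v

/-- Semantic consequence. -/
def Entails {L : FirstOrder.Language.{0, 0}} [L.IsOrdered] (α : Set (Fml L 0)) (φ : Fml L 0) : Prop :=
  ∀ (M : Type) [Nonempty M] [L.Structure M],
    (∀ ψ ∈ α, ψ.Realize (Fin.elim0 : Fin 0 → M)) → φ.Realize (Fin.elim0 : Fin 0 → M)

/-! ### The hierarchy over a class of bounded formulas -/

mutual
/-- `Π_k` formulas over the class `Δ` (the blocks of quantifiers may be empty). -/
inductive IsPi {L : FirstOrder.Language.{0, 0}} (Δ : ∀ n, Set (Fml L n)) : ℕ → ∀ {n : ℕ}, Fml L n → Prop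
  | delta {n : ℕ} {φ : Fml L n} : φ ∈ Δ n → IsPi Δ 0 φ
  | ofSigma {k n : ℕ} {φ : Fml L n} : IsSigma Δ k φ → IsPi Δ (k + 1) φ
  | all {k n : ℕ} {φ : Fml L (n + 1)} : IsPi Δ (k + 1) φ → IsPi Δ (k + 1) φ.all
/-- `Σ_k` formulas over the class `Δ`. -/
inductive IsSigma {L : FirstOrder.Language.{0, 0}} (Δ : ∀ n, Set (Fml L n)) : ℕ → ∀ {n : ℕ}, Fml L n → Prop
  | delta {n : ℕ} {φ : Fml L n} : φ ∈ Δ n → IsSigma Δ 0 φ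
  | ofPi {k n : ℕ} {φ : Fml L n} : IsPi Δ k φ → IsSigma Δ (k + 1) φ
  | ex {k n : ℕ} {φ : Fml L (n + 1)} : IsSigma Δ (k + 1) φ → IsSigma Δ (k + 1) φ.ex
end

/-! ### Deduction methods with their Gödel numberings -/

/-- The relations on `ℕ` of the linear-time hierarchy, presented as the constructive arithmetic
(rudimentary, `Δ₀`) relations: they are generated from the graphs of addition and multiplication by
Boolean operations, explicit transformations (permuting and identifying variables, adding dummy
variables, inserting constants), and quantification bounded by a variable. -/
inductive LinH : {n : ℕ} → ((Fin n → ℕ) → Prop) → Prop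
  | add : LinH (n := 3) fun v => v 0 + v 1 = v 2
  | mul : LinH (n := 3) fun v => v 0 * v 1 = v 2
  | not {n : ℕ} {R : (Fin n → ℕ) → Prop} : LinH R → LinH fun v => ¬ R v
  | and {n : ℕ} {R S : (Fin n → ℕ) → Prop} : LinH R → LinH S → LinH fun v => R v ∧ S v
  | explicit {n m : ℕ} {R : (Fin n → ℕ) → Prop} (f : Fin n → Fin m ⊕ ℕ) :
      LinH R → LinH fun v : Fin m → ℕ => R fun i => Sum.elim v id (f i)
  | bex {n : ℕ} {R : (Fin (n + 1) → ℕ) → Prop} (i : Fin n) :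
      LinH R → LinH fun v => ∃ a ≤ v i, R (Fin.snoc v a : Fin (n + 1) → ℕ)

/-- A deduction method for `L` together with its Gödel numbering: `code` numbers the formulas, and
`Prf α φ p` says that `p` is the Gödel number of a proof of `φ` from the axiom system `α`. -/
structure ProofSystem (L : FirstOrder.Language.{0, 0}) where
  code : (Σ n, Fml L n) → ℕ
  code_injective : Function.Injective code
  Prf : Set (Fml L 0) → Fml L 0 → ℕ → Prop

namespace ProofSystem

variable {L : FirstOrder.Language.{0, 0}} (d : ProofSystem L)

/-- The Gödel number of a sentence. -/
def gn (φ : Fml L 0) : ℕ := d.code ⟨0, φ⟩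

/-- `φ` is a theorem of `(α, d)`. -/
def Provable (α : Set (Fml L 0)) (φ : Fml L 0) : Prop := ∃ p, d.Prf α φ p

/-- The axiom system is recursively enumerable. -/
def IsRE (α : Set (Fml L 0)) : Prop := REPred fun n : ℕ => ∃ φ ∈ α, d.gn φ = n

/-- No sentence is provable together with its negation. -/
def Consistent (α : Set (Fml L 0)) : Prop := ∀ φ, ¬ (d.Provable α φ ∧ d.Provable α φ.not)

/-- `p` is a proof from `α` of the sentence with Gödel number `t`. -/
def PrfRel (α : Set (Fml L 0)) (t p : ℕ) : Prop := ∃ φ, d.gn φ = t ∧ d.Prf α φ p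

/-- `p` is a proof of the sentence with Gödel number `t` from the union of `α` with the sentence
whose Gödel number is `h`. -/
def ExPrfRel (α : Set (Fml L 0)) (h t p : ℕ) : Prop :=
  ∃ ψ φ, d.gn ψ = h ∧ d.gn φ = t ∧ d.Prf (insert ψ α) φ p

/-- `x` is the Gödel number of a `Π_k` sentence and `y` that of the `Σ_k` sentence which is its
negation. -/
def NegRel (Δ : ∀ n, Set (Fml L n)) (k x y : ℕ) : Prop :=
  ∃ φ : Fml L 0, IsPi Δ k φ ∧ d.gn φ = x ∧ d.gn φ.prenexNeg = y

/-- `g` is the Gödel number of a formula, and `h` that of the sentence which replaces all the free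
variables of this formula by the numeral of `g`. -/
def SubstRel (num : ℕ → L.Term Empty) (g h : ℕ) : Prop :=
  ∃ (n : ℕ) (φ : Fml L n), d.code ⟨n, φ⟩ = g ∧
    d.gn (φ.subst fun _ => (num g).relabel Empty.elim) = h

end ProofSystem

/-! ### Generic configurations -/

/-- A generic configuration `(L, Δ₀, B, d, g)`; the pair `(d, g)` is the field `d`.  The instance
`std` is the standard model of the language. -/
structure GenericConfiguration where
  /- 1. The language and its standard model; `num k` is a closed term with value `k`. -/
  L : FirstOrder.Language.{0, 0}
  [ord : L.IsOrdered]
  [std : L.Structure ℕ]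
  zero : L.Constants
  one : L.Constants
  two : L.Constants
  maxSymb : L.Functions 2
  std_zero : Structure.funMap zero ![] = (0 : ℕ)
  std_one : Structure.funMap one ![] = (1 : ℕ)
  std_two : Structure.funMap two ![] = (2 : ℕ)
  std_maxSymb : ∀ a b : ℕ, Structure.funMap maxSymb ![a, b] = max a b
  std_le : ∀ a b : ℕ, Structure.RelMap (leSymb : L.Relations 2) ![a, b] ↔ a ≤ b
  num : ℕ → L.Term Empty
  std_num : ∀ k : ℕ, (num k).realize (Empty.elim : Empty → ℕ) = k
  /- 2. The class of `Δ₀` formulas: fully bounded formulas, closed under the connectives, under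
  substituting variables and numerals for variables, and under quantification bounded by a variable,
  in which the graphs of addition and multiplication are expressible. -/
  Δ₀ : ∀ n, Set (Fml L n)
  fullyBounded : ∀ {n : ℕ} {φ : Fml L n}, φ ∈ Δ₀ n → φ.FullyBounded
  not_mem : ∀ {n : ℕ} {φ : Fml L n}, φ ∈ Δ₀ n → φ.not ∈ Δ₀ n
  and_mem : ∀ {n : ℕ} {φ ψ : Fml L n}, φ ∈ Δ₀ n → ψ ∈ Δ₀ n → φ.and ψ ∈ Δ₀ n
  or_mem : ∀ {n : ℕ} {φ ψ : Fml L n}, φ ∈ Δ₀ n → ψ ∈ Δ₀ n → φ.or ψ ∈ Δ₀ n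
  imp_mem : ∀ {n : ℕ} {φ ψ : Fml L n}, φ ∈ Δ₀ n → ψ ∈ Δ₀ n → φ.imp ψ ∈ Δ₀ n
  subst_mem : ∀ {n m : ℕ} {φ : Fml L n} (σ : Fin n → L.Term (Fin m)),
    (∀ i, (∃ j, σ i = Term.var j) ∨ ∃ k, σ i = (num k).relabel Empty.elim) →
    φ ∈ Δ₀ n → φ.subst σ ∈ Δ₀ m
  ball_mem : ∀ {n : ℕ} {φ : Fml L (n + 1)} (i : Fin n),
    φ ∈ Δ₀ (n + 1) → Fml.ball (Term.var i) φ ∈ Δ₀ n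
  bex_mem : ∀ {n : ℕ} {φ : Fml L (n + 1)} (i : Fin n),
    φ ∈ Δ₀ (n + 1) → Fml.bex (Term.var i) φ ∈ Δ₀ n
  addGraph : ∃ φ ∈ Δ₀ 3, ∀ v : Fin 3 → ℕ, φ.Realize v ↔ v 0 + v 1 = v 2
  mulGraph : ∃ φ ∈ Δ₀ 3, ∀ v : Fin 3 → ℕ, φ.Realize v ↔ v 0 * v 1 = v 2
  /- 3. and 4. The base axiom system is true and `Σ₁` complete, and the deduction method `d`
  satisfies Gödel's completeness theorem. -/
  B : Set (Fml L 0)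
  d : ProofSystem L
  B_true : ∀ φ ∈ B, φ.Realize (Fin.elim0 : Fin 0 → ℕ)
  sigma_complete : ∀ φ : Fml L 0, IsSigma Δ₀ 1 φ → φ.Realize (Fin.elim0 : Fin 0 → ℕ) →
    d.Provable B φ
  complete : ∀ (α : Set (Fml L 0)) (φ : Fml L 0), d.Provable α φ ↔ Entails α φ
  /- 5. The Gödel numbering is a conventional one: a proof remains a proof if an axiom is added; an
  axiom which a proof uses has a Gödel number not exceeding that of the proof; and the elementary
  syntactic relations (negating `Π_k` sentences, substituting numerals, and checking proofs from
  finite extensions of the base system) belong to the linear-time hierarchy. -/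
  prf_insert : ∀ {α : Set (Fml L 0)} (ψ : Fml L 0) {φ : Fml L 0} {p : ℕ},
    d.Prf α φ p → d.Prf (insert ψ α) φ p
  gn_le_of_prf : ∀ {α : Set (Fml L 0)} {ψ φ : Fml L 0} {p : ℕ},
    d.Prf (insert ψ α) φ p → ¬ d.Prf α φ p → d.gn ψ ≤ p
  linH_neg : ∀ k : ℕ, LinH (n := 2) fun v => d.NegRel Δ₀ k (v 0) (v 1)
  linH_subst : LinH (n := 2) fun v => d.SubstRel num (v 0) (v 1)
  linH_prf : ∀ F : Set (Fml L 0), F.Finite →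
    LinH (n := 3) fun v => d.ExPrfRel (F ∪ B) (v 0) (v 1) (v 2)

namespace GenericConfiguration

attribute [instance] GenericConfiguration.ord GenericConfiguration.std

variable (ξ : GenericConfiguration)

/-- Truth of a sentence in the standard model. -/
def Holds (φ : Fml ξ.L 0) : Prop := φ.Realize (Fin.elim0 : Fin 0 → ℕ)

/-- A `Π_1` or `Σ_1` sentence is `Good N` if it is true in the standard model after the unbounded
quantifiers have been restricted to numbers below `2 ^ N`. -/
def Good (N : EReal) (φ : Fml ξ.L 0) : Prop := φ.RealizeScope N Fin.elim0

/-- The largest integer `J` such that all members of `θ` are `Good J`; it is `⊤` if they are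
`Good J` for all `J`, and `⊥` if there is no such `J`. -/
noncomputable def sharp (θ : Set (Fml ξ.L 0)) : EReal :=
  sSup {N : EReal | ∃ J : ℕ, N = (J : EReal) ∧ ∀ φ ∈ θ, ξ.Good (J : EReal) φ}

/-- A recursively enumerable set of (true or false) `Π_1` sentences. -/
def IsRView (θ : Set (Fml ξ.L 0)) : Prop := (∀ φ ∈ θ, IsPi ξ.Δ₀ 1 φ) ∧ ξ.d.IsRE θ

/-- `Log p ≤ ♯ θ + 1`. -/
def IsShort (θ : Set (Fml ξ.L 0)) (p : ℕ) : Prop := ((Real.logb 2 p : ℝ) : EReal) ≤ ξ.sharp θ + 1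

def AStable : Prop := ∀ θ, ξ.IsRView θ → ∀ φ, IsPi ξ.Δ₀ 1 φ → ∀ p, ξ.d.Prf (θ ∪ ξ.B) φ p →
  ξ.IsShort θ p → ξ.Good (ξ.sharp θ / 2) φ

def EStable : Prop := ∀ θ, ξ.IsRView θ → ∀ φ, IsSigma ξ.Δ₀ 1 φ → ∀ p, ξ.d.Prf (θ ∪ ξ.B) φ p →
  ξ.IsShort θ p → ξ.Good (((1 / 2 : ℝ) * ⌊Real.logb 2 p⌋ - 1 : ℝ) : EReal) φ

def EAStable : Prop := ξ.EStable ∧ ξ.AStable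

def ZeroStable : Prop := ∀ θ, ξ.IsRView θ → ∀ φ, φ ∈ ξ.Δ₀ 0 → ∀ p, ξ.d.Prf (θ ∪ ξ.B) φ p →
  ξ.IsShort θ p → ξ.Holds φ

/-- There are no proofs from `α` of both a `Π_k` sentence and the `Σ_k` sentence that is its
negation. -/
def LevelConsistent (k : ℕ) (α : Set (Fml ξ.L 0)) : Prop :=
  ∀ φ, IsPi ξ.Δ₀ k φ → ¬ (ξ.d.Provable α φ ∧ ξ.d.Provable α φ.prenexNeg)

/-! ### The self-referential consistency sentence -/

/-- `Δ₀` formulas `Neg^k(x, y)`, `Prf_β(t, p)`, `Subst(g, h)` and `ExPrf_β(h, t, p)` expressing, in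
the standard model, the syntactic relations after which they are named. -/
structure Encoding (k : ℕ) (β : Set (Fml ξ.L 0)) where
  neg : Fml ξ.L 2
  prf : Fml ξ.L 2
  sub : Fml ξ.L 2
  exPrf : Fml ξ.L 3
  neg_mem : neg ∈ ξ.Δ₀ 2
  prf_mem : prf ∈ ξ.Δ₀ 2
  sub_mem : sub ∈ ξ.Δ₀ 2
  exPrf_mem : exPrf ∈ ξ.Δ₀ 3
  neg_iff : ∀ x y : ℕ, neg.Realize ![x, y] ↔ ξ.d.NegRel ξ.Δ₀ k x y
  prf_iff : ∀ t p : ℕ, prf.Realize ![t, p] ↔ ξ.d.PrfRel β t p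
  sub_iff : ∀ g h : ℕ, sub.Realize ![g, h] ↔ ξ.d.SubstRel ξ.num g h
  exPrf_iff : ∀ h t p : ℕ, exPrf.Realize ![h, t, p] ↔ ξ.d.ExPrfRel β h t p

namespace Encoding

variable {ξ} {k : ℕ} {β : Set (Fml ξ.L 0)} (e : ξ.Encoding k β)

/-- `SubstPrf_β(g, t, p)`, the formula
`Prf_β(t, p) ∨ ∃ h ≤ p, (Subst(g, h) ∧ ExPrf_β(h, t, p))`
in the variables `g = 0`, `t = 1`, `p = 2`, `h = 3`. -/
def substPrf : Fml ξ.L 3 :=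
  (e.prf.rename ![1, 2]).or
    (.bex (Term.var 2) ((e.sub.rename ![0, 3]).and (e.exPrf.rename ![3, 1, 2])))

/-- `Γ^k(g)`, the formula
`∀ x y p q, ¬ (Neg^k(x, y) ∧ SubstPrf_β(g, x, p) ∧ SubstPrf_β(g, y, q))`
in the variables `g = 0`, `x = 1`, `y = 2`, `p = 3`, `q = 4`. -/
def gamma : Fml ξ.L 1 :=
  .all <| .all <| .all <| .all <| .not <|
    (e.neg.rename ![1, 2]).and <|
      (e.substPrf.rename ![0, 1, 3]).and (e.substPrf.rename ![0, 2, 4])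

/-- The sentence `SelfCons^k(β, d)`, namely `Γ^k(n)` for the Gödel number `n` of `Γ^k(g)`.  It
declares the Level-`k` consistency of the system `β + SelfCons^k(β, d)`. -/
def selfCons : Fml ξ.L 0 :=
  e.gamma.subst fun _ => (ξ.num (ξ.d.code ⟨1, e.gamma⟩)).relabel Empty.elim

end Encoding

/-- `α` recognizes its own Level-`k` consistency through the encoding `e`: it consists of `β` and
the sentence which declares the Level-`k` consistency of `β` together with this very sentence, and
it proves this sentence. -/
def RecognizesLevelConsistency {k : ℕ} {β : Set (Fml ξ.L 0)} (α : Set (Fml ξ.L 0))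
    (e : ξ.Encoding k β) : Prop :=
  α = insert e.selfCons β ∧ ξ.d.Provable α e.selfCons

/-- `α` is obtained from the base system by adding finitely many axioms. -/
def IsFinitizedExtension (α : Set (Fml ξ.L 0)) : Prop := ξ.B ⊆ α ∧ (α \ ξ.B).Finite

/-! ### Global simulation -/

/-- `prf(t, q)` is a `Δ₀` formula indicating that `q` is a proof, from the axiom system `𝓑` and by
the deduction method `D`, of the sentence with Gödel number `t`.  The language of `𝓑` is an
extension `ι` of the language of `ξ`. -/
def IsPrfFormula {L' : FirstOrder.Language.{0, 0}} (ι : ξ.L →ᴸ L') (D : ProofSystem L') (𝓑 : Set (Fml L' 0))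
    (prf : Fml ξ.L 2) : Prop :=
  prf ∈ ξ.Δ₀ 2 ∧
    ∀ (φ : Fml ξ.L 0) (q : ℕ), prf.Realize ![ξ.d.gn φ, q] ↔ D.Prf 𝓑 (φ.onLHom ι) q

/-- `check(t)` is a `Δ₀` formula indicating that `t` is the Gödel number of a `Π_1` sentence. -/
def IsCheckFormula (check : Fml ξ.L 1) : Prop :=
  check ∈ ξ.Δ₀ 1 ∧
    ∀ t : ℕ, check.Realize ![t] ↔ ∃ φ : Fml ξ.L 0, IsPi ξ.Δ₀ 1 φ ∧ ξ.d.gn φ = t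

/-- The `Δ₀` formulas `test(t, x)` such that `φ ↔ ∀ x, test(⌜φ⌝, x)` is true for all `Π_1`
sentences `φ`. -/
def TestFormulas : Set (Fml ξ.L 2) :=
  {test | test ∈ ξ.Δ₀ 2 ∧
    ∀ φ : Fml ξ.L 0, IsPi ξ.Δ₀ 1 φ → (ξ.Holds φ ↔ ∀ x : ℕ, test.Realize ![ξ.d.gn φ, x])}

/-- The global simulation sentence
`∀ t q x, (prf(t, q) ∧ check(t)) → test(t, x)`. -/
def globSim (prf : Fml ξ.L 2) (check : Fml ξ.L 1) (test : Fml ξ.L 2) : Fml ξ.L 0 :=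
  .all <| .all <| .all <|
    ((prf.rename ![0, 1]).and (check.rename ![0])).imp (test.rename ![0, 2])

end GenericConfiguration

-- The crux is that the self-consistency sentence is true; the rest is soundness. Write G for the
-- simulation sentence and S for `selfCons`. G is Π₁, and true because the Π₁ theorems of the
-- simulated system are true.
--
-- Suppose S is false. Let M be the least bound for a quadruple x, y, p, q refuting it, and let J =
-- ⌊Log M⌋. Such a quadruple codes proofs p, q, from the base system with G and S, of a Π_k sentence
-- and of its negation (`exists_prf_of_not_realize`). By minimality S has no counterexample below
-- 2^J, so S is Good(J), while p and q are below 2^(J+1) (`exists_short_prf`). With θ = {S, G}, the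
-- true sentence G does not lower ♯θ. Hence J ≤ ♯θ, and both proofs satisfy the length bound Log ≤
-- ♯θ + 1 of the stability conditions (`exists_short_contradiction`).
--
-- For k = 1, A-stability makes the Π₁ sentence Good(♯θ/2), and E-stability makes its negation
-- Good(⌊Log q⌋/2 - 1). The second scope is the smaller, so the witnesses of the negation refute the
-- sentence inside its own scope. For k = 0 scopes are irrelevant, and each of the three stability
-- notions makes a Δ₀ sentence and its negation both true.
--
-- So S is true, and the extended system has the standard model. This gives consistency, and S is
-- provable as an axiom.

namespace Fml

variable {L : FirstOrder.Language.{0, 0}}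

-- Semantics of substitution, prenex negation and bounded formulas

theorem realize_lift {M : Type} [L.Structure M] {n m : ℕ} (σ : Fin n → L.Term (Fin m))
    (v : Fin m → M) (a : M) :
    (fun i => (lift σ i).realize (Fin.snoc v a : Fin (m + 1) → M)) =
      (Fin.snoc (fun i => (σ i).realize v) a : Fin (n + 1) → M) := by
  funext i
  refine Fin.lastCases ?_ (fun i => ?_) i
  · simp [lift]
  · simp only [lift, Fin.snoc_castSucc, Term.realize_relabel]
    congr 1
    funext j
    simp

theorem realize_subst [L.IsOrdered] {M : Type} [L.Structure M] {n : ℕ} (φ : Fml L n) :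
    ∀ {m : ℕ} (σ : Fin n → L.Term (Fin m)) (v : Fin m → M),
      (φ.subst σ).Realize v ↔ φ.Realize fun i => (σ i).realize v := by
  induction φ with
  | eq s t => intro m σ v; simp [subst, Realize]
  | rel R ts => intro m σ v; simp [subst, Realize]
  | not φ ih => intro m σ v; simp [subst, Realize, ih]
  | and φ ψ ih₁ ih₂ => intro m σ v; simp [subst, Realize, ih₁, ih₂]
  | or φ ψ ih₁ ih₂ => intro m σ v; simp [subst, Realize, ih₁, ih₂]
  | imp φ ψ ih₁ ih₂ => intro m σ v; simp [subst, Realize, ih₁, ih₂]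
  | all φ ih => intro m σ v; simp [subst, Realize, ih, realize_lift]
  | ex φ ih => intro m σ v; simp [subst, Realize, ih, realize_lift]
  | ball t φ ih => intro m σ v; simp [subst, Realize, ih, realize_lift]
  | bex t φ ih => intro m σ v; simp [subst, Realize, ih, realize_lift]

theorem realize_rename [L.IsOrdered] {M : Type} [L.Structure M] {n m : ℕ} (φ : Fml L n) (f : Fin n → Fin m)
    (v : Fin m → M) : (φ.rename f).Realize v ↔ φ.Realize fun i => v (f i) := by
  simp [rename, realize_subst]

theorem realize_prenexNeg [L.IsOrdered] {M : Type} [L.Structure M] {n : ℕ} (φ : Fml L n) (v : Fin n → M) :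
    φ.prenexNeg.Realize v ↔ ¬ φ.Realize v := by
  induction φ <;> simp_all [prenexNeg, Realize]

/-- The two differ in truth value over ℕ. Through injectivity of the numbering, this excludes the
all-zero quadruple as a refutation of `selfCons`. -/
theorem prenexNeg_ne [L.IsOrdered] [L.Structure ℕ] (φ : Fml L 0) : φ.prenexNeg ≠ φ := fun h => by
  have := realize_prenexNeg φ (Fin.elim0 : Fin 0 → ℕ)
  rw [h] at this
  exact iff_not_self this

theorem FullyBounded.prenexNeg_eq {n : ℕ} {φ : Fml L n} (h : φ.FullyBounded) :
    φ.prenexNeg = φ.not := by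
  cases φ <;> first | rfl | exact h.elim

/-- There is no unbounded prefix to restrict, so goodness of a bounded sentence is plain truth at
every scope. This is why A-stability and E-stability each imply 0-stability. -/
theorem FullyBounded.realizeScope [L.IsOrdered] [L.Structure ℕ] {N : EReal} {n : ℕ} {φ : Fml L n}
    (h : φ.FullyBounded) (v : Fin n → ℕ) : φ.RealizeScope N v ↔ φ.Realize v := by
  cases φ <;> first | exact Iff.rfl | exact h.elim

end Fml

-- Scopes `2 ^ N` for extended real `N`

theorem twoPow_mono {N N' : EReal} (h : N ≤ N') : twoPow N ≤ twoPow N' := by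
  unfold twoPow
  induction N using EReal.rec with
  | bot =>
    simp only [bot_ne_top, if_false, if_true]
    split_ifs
    · exact le_top
    · exact le_rfl
    · exact_mod_cast (Real.rpow_pos_of_pos two_pos _).le
  | top => rw [top_le_iff.1 h]
  | coe a =>
    induction N' using EReal.rec with
    | bot => simp at h
    | top => simp
    | coe b =>
      simp only [EReal.coe_ne_top, EReal.coe_ne_bot, if_false, EReal.toReal_coe]
      exact_mod_cast Real.rpow_le_rpow_of_exponent_le one_le_two (by exact_mod_cast h)

theorem twoPow_natCast (J : ℕ) : twoPow (J : EReal) = (((2 : ℝ) ^ J : ℝ) : EReal) := by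
  have h : (J : EReal) = ((J : ℝ) : EReal) := by simp
  rw [h, twoPow, if_neg (EReal.coe_ne_top _), if_neg (EReal.coe_ne_bot _), EReal.toReal_coe,
    Real.rpow_natCast]

theorem natCast_lt_twoPow_iff (a J : ℕ) : ((a : ℝ) : EReal) < twoPow (J : EReal) ↔ a < 2 ^ J := by
  rw [twoPow_natCast, EReal.coe_lt_coe_iff]
  exact_mod_cast Iff.rfl

-- Π₁ and Σ₁ formulas, their negations and restricted scopes

section Hierarchy

variable {L : FirstOrder.Language.{0, 0}} {Δ : ∀ n, Set (Fml L n)}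

theorem isPi_zero_iff {n : ℕ} {φ : Fml L n} : IsPi Δ 0 φ ↔ φ ∈ Δ n :=
  ⟨fun h => by cases h; assumption, .delta⟩

theorem isSigma_zero_iff {n : ℕ} {φ : Fml L n} : IsSigma Δ 0 φ ↔ φ ∈ Δ n :=
  ⟨fun h => by cases h; assumption, .delta⟩

theorem isPi_one_of_mem {n : ℕ} {φ : Fml L n} (h : φ ∈ Δ n) : IsPi Δ 1 φ :=
  .ofSigma (.delta h)

theorem isSigma_one_of_mem {n : ℕ} {φ : Fml L n} (h : φ ∈ Δ n) : IsSigma Δ 1 φ :=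
  .ofPi (.delta h)

/-- A `Π_1` formula is either bounded or a universal quantification of a `Π_1` formula. -/
theorem isPi_one_cases {n : ℕ} {φ : Fml L n} (h : IsPi Δ 1 φ) :
    φ ∈ Δ n ∨ ∃ ψ : Fml L (n + 1), φ = ψ.all ∧ IsPi Δ 1 ψ := by
  cases h with
  | ofSigma h => exact .inl (isSigma_zero_iff.1 h)
  | all h => exact .inr ⟨_, rfl, h⟩

/-- Dualizing the prefix and negating the matrix stays inside the hierarchy because Δ is closed
under negation. It lets E-stability be applied to the negation of a Π₁ sentence. Induction runs on
the formula, which avoids the mutual predicates. -/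
theorem IsPi.prenexNeg_one (hb : ∀ n, ∀ φ ∈ Δ n, φ.FullyBounded)
    (hn : ∀ n, ∀ φ ∈ Δ n, φ.not ∈ Δ n) {n : ℕ} (φ : Fml L n) (h : IsPi Δ 1 φ) :
    IsSigma Δ 1 φ.prenexNeg := by
  induction φ with
  | all ψ ih =>
    obtain h | ⟨χ, hχ, h⟩ := isPi_one_cases h
    · exact (hb _ _ h).elim
    · cases hχ
      exact .ex (ih h)
  | _ =>
    obtain h | ⟨χ, hχ, -⟩ := isPi_one_cases h
    · rw [(hb _ _ h).prenexNeg_eq]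
      exact isSigma_one_of_mem (hn _ _ h)
    · cases hχ

/-- A `Π_1` formula and its negation cannot both hold if the scope of the negation is the smaller
one. -/
theorem IsPi.not_realizeScope_prenexNeg [L.IsOrdered] [L.Structure ℕ]
    (hb : ∀ n, ∀ φ ∈ Δ n, φ.FullyBounded) {N N' : EReal} (hN : N ≤ N') {n : ℕ} (φ : Fml L n)
    (h : IsPi Δ 1 φ) (v : Fin n → ℕ) (hφ : φ.RealizeScope N' v) :
    ¬ φ.prenexNeg.RealizeScope N v := by
  induction φ with
  | all ψ ih =>
    obtain h | ⟨χ, hχ, h⟩ := isPi_one_cases h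
    · exact (hb _ _ h).elim
    · cases hχ
      rintro ⟨a, ha, hneg⟩
      -- The witness `a` lies below `2 ^ N`, hence within the larger range `2 ^ N'` of the universal
      -- quantifier.
      exact ih h _ (hφ a (ha.trans_le (twoPow_mono hN))) hneg
  | _ =>
    obtain h | ⟨χ, hχ, -⟩ := isPi_one_cases h
    · rw [(hb _ _ h).prenexNeg_eq]
      exact fun hneg => hneg (((hb _ _ h).realizeScope v).1 hφ)
    · cases hχ

/-- A true `Π_1` formula remains true when the scope of its quantifiers is restricted. -/
theorem IsPi.realizeScope_of_realize [L.IsOrdered] [L.Structure ℕ]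
    (hb : ∀ n, ∀ φ ∈ Δ n, φ.FullyBounded) (N : EReal) {n : ℕ} (φ : Fml L n)
    (h : IsPi Δ 1 φ) (v : Fin n → ℕ) (hφ : φ.Realize v) : φ.RealizeScope N v := by
  induction φ with
  | all ψ ih =>
    obtain h | ⟨χ, hχ, h⟩ := isPi_one_cases h
    · exact (hb _ _ h).elim
    · cases hχ
      exact fun a _ => ih h _ (hφ a)
  | _ =>
    obtain h | ⟨χ, hχ, -⟩ := isPi_one_cases h
    · exact ((hb _ _ h).realizeScope v).2 hφ
    · cases hχ

end Hierarchy

-- Expressing relations by Δ₀ formulas, and truth of the simulation sentence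

namespace GenericConfiguration

variable (ξ : GenericConfiguration)

theorem realize_num {n : ℕ} (k : ℕ) (v : Fin n → ℕ) :
    ((ξ.num k).relabel Empty.elim : ξ.L.Term (Fin n)).realize v = k := by
  rw [Term.realize_relabel]
  exact Subsingleton.elim (Empty.elim : Empty → ℕ) (v ∘ Empty.elim) ▸ ξ.std_num k

theorem rename_mem {n m : ℕ} {φ : Fml ξ.L n} (f : Fin n → Fin m) (h : φ ∈ ξ.Δ₀ n) :
    φ.rename f ∈ ξ.Δ₀ m :=
  ξ.subst_mem _ (fun i => .inl ⟨f i, rfl⟩) h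

/-- Every relation of the linear-time hierarchy is expressed by a `Δ₀` formula. -/
theorem exists_mem_realize_iff {n : ℕ} {R : (Fin n → ℕ) → Prop} (h : LinH R) :
    ∃ φ ∈ ξ.Δ₀ n, ∀ v : Fin n → ℕ, φ.Realize v ↔ R v := by
  induction h with
  | add => exact ξ.addGraph
  | mul => exact ξ.mulGraph
  | not _ ih =>
    obtain ⟨φ, hφ, h⟩ := ih
    exact ⟨φ.not, ξ.not_mem hφ, fun v => not_congr (h v)⟩
  | and _ _ ih₁ ih₂ =>
    obtain ⟨φ, hφ, h⟩ := ih₁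
    obtain ⟨ψ, hψ, h'⟩ := ih₂
    exact ⟨φ.and ψ, ξ.and_mem hφ hψ, fun v => and_congr (h v) (h' v)⟩
  | @explicit n m R f _ ih =>
    obtain ⟨φ, hφ, h⟩ := ih
    refine ⟨φ.subst fun i => Sum.elim Term.var (fun k => (ξ.num k).relabel Empty.elim) (f i),
      ξ.subst_mem _ (fun i => ?_) hφ, fun v => ?_⟩
    · cases f i with
      | inl j => exact .inl ⟨j, rfl⟩
      | inr k => exact .inr ⟨k, rfl⟩
    · rw [Fml.realize_subst, h]
      have : (fun i => (Sum.elim Term.var (fun k => (ξ.num k).relabel Empty.elim) (f i) :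
          ξ.L.Term (Fin m)).realize v) = fun i => Sum.elim v id (f i) := by
        funext i
        cases f i with
        | inl j => rfl
        | inr k => exact ξ.realize_num k v
      rw [this]
  | @bex n R i _ ih =>
    obtain ⟨φ, hφ, h⟩ := ih
    refine ⟨.bex (Term.var i) φ, ξ.bex_mem i hφ, fun v => ?_⟩
    simp only [Fml.Realize, Term.realize_var, ξ.std_le, h]

theorem nonempty_encoding (k : ℕ) (G : Fml ξ.L 0) : Nonempty (ξ.Encoding k (insert G ξ.B)) := by
  have hprf := ξ.linH_prf {G} (Set.finite_singleton G)
  rw [Set.singleton_union] at hprf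
  obtain ⟨neg, hneg, neg_iff⟩ := ξ.exists_mem_realize_iff (ξ.linH_neg k)
  obtain ⟨sub, hsub, sub_iff⟩ := ξ.exists_mem_realize_iff ξ.linH_subst
  obtain ⟨exPrf, hexPrf, exPrf_iff⟩ := ξ.exists_mem_realize_iff hprf
  -- A formula for `Prf` comes from `ExPrf` by fixing the extra axiom to be `G`: since `G` already
  -- belongs to the system, inserting it again changes nothing.
  obtain ⟨prf, hprf, prf_iff⟩ := ξ.exists_mem_realize_iff
    (LinH.explicit (m := 2) ![.inr (ξ.d.gn G), .inl 0, .inl 1] hprf)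
  refine ⟨⟨neg, prf, sub, exPrf, hneg, hprf, hsub, hexPrf, fun x y => neg_iff _, fun t p => ?_,
    fun g h => sub_iff _, fun h t p => exPrf_iff _⟩⟩
  rw [prf_iff]
  change ξ.d.ExPrfRel (insert G ξ.B) (ξ.d.gn G) t p ↔ _
  constructor
  · rintro ⟨ψ, φ, hψ, hφ, hp⟩
    obtain rfl : ψ = G := by simpa using ξ.d.code_injective hψ
    exact ⟨φ, hφ, by simpa using hp⟩
  · rintro ⟨φ, hφ, hp⟩
    exact ⟨G, φ, rfl, hφ, by simpa using hp⟩

theorem isPi_globSim {prf : Fml ξ.L 2} {check : Fml ξ.L 1} {test : Fml ξ.L 2}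
    (hprf : prf ∈ ξ.Δ₀ 2) (hcheck : check ∈ ξ.Δ₀ 1) (htest : test ∈ ξ.Δ₀ 2) :
    IsPi ξ.Δ₀ 1 (ξ.globSim prf check test) :=
  .all <| .all <| .all <| isPi_one_of_mem <|
    ξ.imp_mem (ξ.and_mem (ξ.rename_mem _ hprf) (ξ.rename_mem _ hcheck)) (ξ.rename_mem _ htest)

/-- The check formula forces `t` to code a Π₁ sentence and the proof formula makes it a theorem of
the simulated system. It is then true by assumption, so every instance of its test holds. -/
theorem holds_globSim {L' : FirstOrder.Language.{0, 0}} {ι : ξ.L →ᴸ L'} {D : ProofSystem L'}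
    {𝓑 : Set (Fml L' 0)}
    (htrue : ∀ φ : Fml ξ.L 0, IsPi ξ.Δ₀ 1 φ → D.Provable 𝓑 (φ.onLHom ι) → ξ.Holds φ)
    {prf : Fml ξ.L 2} (hprf : ξ.IsPrfFormula ι D 𝓑 prf) {check : Fml ξ.L 1}
    (hcheck : ξ.IsCheckFormula check) {test : Fml ξ.L 2} (htest : test ∈ ξ.TestFormulas) :
    ξ.Holds (ξ.globSim prf check test) := by
  rintro t q x ⟨h₁, h₂⟩
  rw [Fml.realize_rename] at h₁ h₂ ⊢
  have e₁ : ∀ v : Fin 3 → ℕ, (fun i => v ((![0, 1] : Fin 2 → Fin 3) i)) = ![v 0, v 1] := by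
    intro v; funext i; fin_cases i <;> rfl
  have e₂ : ∀ v : Fin 3 → ℕ, (fun i => v ((![0] : Fin 1 → Fin 3) i)) = ![v 0] := by
    intro v; funext i; fin_cases i; rfl
  have e₃ : ∀ v : Fin 3 → ℕ, (fun i => v ((![0, 2] : Fin 2 → Fin 3) i)) = ![v 0, v 2] := by
    intro v; funext i; fin_cases i <;> rfl
  rw [e₁] at h₁
  rw [e₂] at h₂
  rw [e₃]
  change prf.Realize ![t, q] at h₁
  change check.Realize ![t] at h₂
  change test.Realize ![t, x]
  obtain ⟨φ, hφ, rfl⟩ := (hcheck.2 t).1 h₂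
  exact (htest.2 φ hφ).1 (htrue φ hφ ⟨q, (hprf.2 φ q).1 h₁⟩) x

-- The self-consistency sentence and its smallest refutation

namespace Encoding

variable {ξ} {k : ℕ} {β : Set (Fml ξ.L 0)} (e : ξ.Encoding k β)

theorem substPrf_mem : e.substPrf ∈ ξ.Δ₀ 3 :=
  ξ.or_mem (ξ.rename_mem _ e.prf_mem) <| ξ.bex_mem 2 <|
    ξ.and_mem (ξ.rename_mem _ e.sub_mem) (ξ.rename_mem _ e.exPrf_mem)

/-- The matrix of `gamma`. -/
def matrix : Fml ξ.L 5 :=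
  .not <| (e.neg.rename ![1, 2]).and <|
    (e.substPrf.rename ![0, 1, 3]).and (e.substPrf.rename ![0, 2, 4])

theorem matrix_mem : e.matrix ∈ ξ.Δ₀ 5 :=
  ξ.not_mem <| ξ.and_mem (ξ.rename_mem _ e.neg_mem) <|
    ξ.and_mem (ξ.rename_mem _ e.substPrf_mem) (ξ.rename_mem _ e.substPrf_mem)

/-- The matrix of `selfCons`. -/
def selfMatrix : Fml ξ.L 4 :=
  e.matrix.subst <| Fml.lift <| Fml.lift <| Fml.lift <| Fml.lift
    fun _ => (ξ.num (ξ.d.code ⟨1, e.gamma⟩)).relabel Empty.elim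

theorem selfCons_eq : e.selfCons = e.selfMatrix.all.all.all.all := rfl

/-- Δ₀ is closed only under substituting variables and numerals, so a substitution carried under
quantifiers must keep this shape. Numerals do, because relabelling a closed term twice is
relabelling it once. -/
theorem lift_var_or_num {n m : ℕ} (σ : Fin n → ξ.L.Term (Fin m))
    (h : ∀ i, (∃ j, σ i = Term.var j) ∨ ∃ k, σ i = (ξ.num k).relabel Empty.elim) (i : Fin (n + 1)) :
    (∃ j, Fml.lift σ i = Term.var j) ∨ ∃ k, Fml.lift σ i = (ξ.num k).relabel Empty.elim := by
  refine Fin.lastCases ?_ (fun i => ?_) i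
  · exact .inl ⟨Fin.last m, by simp [Fml.lift]⟩
  · obtain ⟨j, hj⟩ | ⟨k, hk⟩ := h i
    · exact .inl ⟨j.castSucc, by simp [Fml.lift, hj]⟩
    · refine .inr ⟨k, ?_⟩
      simp only [Fml.lift, Fin.snoc_castSucc, hk, Term.relabel_relabel]
      congr 1
      exact Subsingleton.elim _ _

theorem selfMatrix_mem : e.selfMatrix ∈ ξ.Δ₀ 4 :=
  ξ.subst_mem _ (lift_var_or_num _ <| lift_var_or_num _ <| lift_var_or_num _ <|
    lift_var_or_num _ fun _ => .inr ⟨_, rfl⟩) e.matrix_mem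

theorem isPi_selfCons : IsPi ξ.Δ₀ 1 e.selfCons :=
  .all <| .all <| .all <| .all <| isPi_one_of_mem e.selfMatrix_mem

/-- If `SubstPrf` holds at the Gödel number of `gamma`, then `p` is a proof from the system
extended by `selfCons`. -/
theorem prfRel_of_realize_substPrf {t p : ℕ}
    (h : e.substPrf.Realize ![ξ.d.code ⟨1, e.gamma⟩, t, p]) :
    ξ.d.PrfRel (insert e.selfCons β) t p := by
  obtain h | ⟨a, -, h₁, h₂⟩ := h
  · rw [Fml.realize_rename] at h
    have : (fun i => (![ξ.d.code ⟨1, e.gamma⟩, t, p] : Fin 3 → ℕ) ((![1, 2] : Fin 2 → Fin 3) i)) =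
        ![t, p] := by
      funext i; fin_cases i <;> rfl
    rw [this] at h
    obtain ⟨φ, hφ, hp⟩ := (e.prf_iff t p).1 h
    exact ⟨φ, hφ, ξ.prf_insert _ hp⟩
  · rw [Fml.realize_rename] at h₁ h₂
    have e₁ : ∀ v : Fin 4 → ℕ, (fun i => v ((![0, 3] : Fin 2 → Fin 4) i)) = ![v 0, v 3] := by
      intro v; funext i; fin_cases i <;> rfl
    have e₂ : ∀ v : Fin 4 → ℕ,
        (fun i => v ((![3, 1, 2] : Fin 3 → Fin 4) i)) = ![v 3, v 1, v 2] := by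
      intro v; funext i; fin_cases i <;> rfl
    rw [e₁] at h₁
    rw [e₂] at h₂
    obtain ⟨n, φ, hφ, hs⟩ := (e.sub_iff (ξ.d.code ⟨1, e.gamma⟩) a).1 h₁
    obtain ⟨ψ, χ, hψ, hχ, hp⟩ := (e.exPrf_iff a t p).1 h₂
    -- Here the diagonalization closes: injectivity identifies the coded formula with `gamma`, so
    -- the extra axiom coded by `a` is `selfCons` itself.
    cases ξ.d.code_injective hφ
    obtain rfl : e.selfCons = ψ := by simpa [selfCons] using ξ.d.code_injective (hs.trans hψ.symm)
    exact ⟨χ, hχ, hp⟩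

/-- The numbers `x, y, p, q` refute `selfCons` only if `p` and `q` prove a `Π_k` sentence and its
negation. -/
theorem exists_prf_of_not_realize {x y p q : ℕ} (h : ¬ e.selfMatrix.Realize ![x, y, p, q]) :
    ∃ φ : Fml ξ.L 0, IsPi ξ.Δ₀ k φ ∧ ξ.d.gn φ = x ∧ ξ.d.gn φ.prenexNeg = y ∧
      ξ.d.Prf (insert e.selfCons β) φ p ∧ ξ.d.Prf (insert e.selfCons β) φ.prenexNeg q := by
  have hv : (![x, y, p, q] : Fin 4 → ℕ) =
      (Fin.snoc (Fin.snoc (Fin.snoc (Fin.snoc Fin.elim0 x : Fin 1 → ℕ) y : Fin 2 → ℕ) p :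
        Fin 3 → ℕ) q : Fin 4 → ℕ) := by
    funext i; fin_cases i <;> rfl
  have hw : ∀ g : ℕ, (Fin.snoc (Fin.snoc (Fin.snoc (Fin.snoc (fun _ => g : Fin 1 → ℕ) x :
      Fin 2 → ℕ) y : Fin 3 → ℕ) p : Fin 4 → ℕ) q : Fin 5 → ℕ) = ![g, x, y, p, q] := by
    intro g; funext i; fin_cases i <;> rfl
  rw [selfMatrix, Fml.realize_subst, hv] at h
  simp only [Fml.realize_lift, ξ.realize_num] at h
  rw [hw] at h
  obtain ⟨h₁, h₂, h₃⟩ := not_not.1 h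
  rw [Fml.realize_rename] at h₁ h₂ h₃
  have e₁ : ∀ v : Fin 5 → ℕ, (fun i => v ((![1, 2] : Fin 2 → Fin 5) i)) = ![v 1, v 2] := by
    intro v; funext i; fin_cases i <;> rfl
  have e₂ : ∀ v : Fin 5 → ℕ,
      (fun i => v ((![0, 1, 3] : Fin 3 → Fin 5) i)) = ![v 0, v 1, v 3] := by
    intro v; funext i; fin_cases i <;> rfl
  have e₃ : ∀ v : Fin 5 → ℕ,
      (fun i => v ((![0, 2, 4] : Fin 3 → Fin 5) i)) = ![v 0, v 2, v 4] := by
    intro v; funext i; fin_cases i <;> rfl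
  rw [e₁] at h₁
  rw [e₂] at h₂
  rw [e₃] at h₃
  obtain ⟨φ, hφ, rfl, rfl⟩ := (e.neg_iff x y).1 h₁
  obtain ⟨χ, hχ, hp⟩ := e.prfRel_of_realize_substPrf h₂
  obtain ⟨χ', hχ', hq⟩ := e.prfRel_of_realize_substPrf h₃
  obtain rfl : χ = φ := by simpa using ξ.d.code_injective hχ
  obtain rfl : χ' = χ.prenexNeg := by simpa using ξ.d.code_injective hχ'
  exact ⟨χ, hφ, rfl, rfl, hp, hq⟩

theorem good_selfCons_iff (J : ℕ) : ξ.Good (J : EReal) e.selfCons ↔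
    ∀ x < 2 ^ J, ∀ y < 2 ^ J, ∀ p < 2 ^ J, ∀ q < 2 ^ J, e.selfMatrix.Realize ![x, y, p, q] := by
  have hv : ∀ x y p q : ℕ, (Fin.snoc (Fin.snoc (Fin.snoc (Fin.snoc Fin.elim0 x : Fin 1 → ℕ) y :
      Fin 2 → ℕ) p : Fin 3 → ℕ) q : Fin 4 → ℕ) = ![x, y, p, q] := by
    intro x y p q; funext i; fin_cases i <;> rfl
  rw [Good, selfCons_eq]
  simp only [Fml.RealizeScope, natCast_lt_twoPow_iff,
    (ξ.fullyBounded e.selfMatrix_mem).realizeScope, hv]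

theorem holds_selfCons_iff : ξ.Holds e.selfCons ↔
    ∀ x y p q : ℕ, e.selfMatrix.Realize ![x, y, p, q] := by
  have hv : ∀ x y p q : ℕ, (Fin.snoc (Fin.snoc (Fin.snoc (Fin.snoc Fin.elim0 x : Fin 1 → ℕ) y :
      Fin 2 → ℕ) p : Fin 3 → ℕ) q : Fin 4 → ℕ) = ![x, y, p, q] := by
    intro x y p q; funext i; fin_cases i <;> rfl
  rw [Holds, selfCons_eq]
  simp only [Fml.Realize, hv]

/-- If `selfCons` is false, a `Π_k` sentence and its negation have proofs which are short in
comparison with a scope within which `selfCons` is good. -/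
theorem exists_short_prf (h : ¬ ξ.Holds e.selfCons) :
    ∃ (φ : Fml ξ.L 0) (p q J : ℕ), IsPi ξ.Δ₀ k φ ∧
      ξ.d.Prf (insert e.selfCons β) φ p ∧ ξ.d.Prf (insert e.selfCons β) φ.prenexNeg q ∧
      p < 2 ^ (J + 1) ∧ q < 2 ^ (J + 1) ∧ ξ.Good (J : EReal) e.selfCons := by
  classical
  -- One common bound for all four numbers, so that its least value controls the proofs and the
  -- goodness of `selfCons` together.
  have hex : ∃ M : ℕ, ∃ x ≤ M, ∃ y ≤ M, ∃ p ≤ M, ∃ q ≤ M,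
      ¬ e.selfMatrix.Realize ![x, y, p, q] := by
    rw [holds_selfCons_iff] at h
    push Not at h
    obtain ⟨x, y, p, q, h⟩ := h
    exact ⟨x + y + p + q, x, by omega, y, by omega, p, by omega, q, by omega, h⟩
  obtain ⟨x, hx, y, hy, p, hp, q, hq, hr⟩ := Nat.find_spec hex
  obtain ⟨φ, hφ, hφx, hφy, hφp, hφq⟩ := e.exists_prf_of_not_realize hr
  -- A zero bound would give a sentence and its negation the same code. The case must be excluded
  -- because `2 ^ Nat.log 2 M ≤ M` fails at `M = 0`.
  have hM : Nat.find hex ≠ 0 := fun h0 => by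
    have hxy : ξ.d.gn φ.prenexNeg = ξ.d.gn φ := by omega
    exact φ.prenexNeg_ne (by simpa using ξ.d.code_injective hxy)
  have hlt := Nat.lt_pow_succ_log_self one_lt_two (Nat.find hex)
  have hle := Nat.pow_log_le_self 2 hM
  refine ⟨φ, p, q, Nat.log 2 (Nat.find hex), hφ, hφp, hφq, hp.trans_lt hlt, hq.trans_lt hlt, ?_⟩
  rw [good_selfCons_iff]
  intro x hx y hy p hp q hq
  by_contra hr
  -- Numbers below `2 ^ J ≤ M` are at most `M - 1`, so a refutation among them would contradict
  -- minimality of `M`.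
  have := Nat.find_min hex (m := Nat.find hex - 1) (by omega)
  exact this ⟨x, by omega, y, by omega, p, by omega, q, by omega, hr⟩

end Encoding

-- Short contradictions against stability

theorem isRE_pair (d : ProofSystem ξ.L) (φ ψ : Fml ξ.L 0) : d.IsRE {φ, ψ} := by
  have : (fun n : ℕ => ∃ χ ∈ ({φ, ψ} : Set (Fml ξ.L 0)), d.gn χ = n) =
      fun n => n = d.gn φ ∨ n = d.gn ψ := by
    funext n
    simp [eq_comm]
  rw [ProofSystem.IsRE, this]
  exact (PrimrecPred.or (Primrec.eq.comp .id (.const _))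
    (Primrec.eq.comp .id (.const _))).computablePred.to_re

theorem logb_lt_of_lt_two_pow {p J : ℕ} (h : p < 2 ^ (J + 1)) : Real.logb 2 p < J + 1 := by
  rcases Nat.eq_zero_or_pos p with rfl | hp
  -- `Real.logb 2 0 = 0` agrees with the convention Log(0) = 0.
  · simp only [Nat.cast_zero, Real.logb_zero]
    positivity
  · rw [Real.logb_lt_iff_lt_rpow one_lt_two (by exact_mod_cast hp)]
    exact_mod_cast h

theorem isShort_of_lt_two_pow {θ : Set (Fml ξ.L 0)} {p J : ℕ} (hJ : (J : EReal) ≤ ξ.sharp θ)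
    (h : p < 2 ^ (J + 1)) : ξ.IsShort θ p := by
  have h₁ : ((Real.logb 2 p : ℝ) : EReal) ≤ (J : EReal) + 1 := by
    exact_mod_cast (logb_lt_of_lt_two_pow h).le
  exact h₁.trans (add_le_add_left hJ 1)

/-- A false self-consistency sentence yields a set of `Π_1` sentences, together with the base system
proving a `Π_k` sentence and its negation by short proofs. -/
theorem exists_short_contradiction {k : ℕ} {G : Fml ξ.L 0} (hG : IsPi ξ.Δ₀ 1 G) (hGt : ξ.Holds G)
    (e : ξ.Encoding k (insert G ξ.B)) (h : ¬ ξ.Holds e.selfCons) :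
    ∃ (θ : Set (Fml ξ.L 0)) (φ : Fml ξ.L 0) (p q J : ℕ), ξ.IsRView θ ∧ IsPi ξ.Δ₀ k φ ∧
      ξ.d.Prf (θ ∪ ξ.B) φ p ∧ ξ.d.Prf (θ ∪ ξ.B) φ.prenexNeg q ∧ ξ.IsShort θ p ∧ ξ.IsShort θ q ∧
      (J : EReal) ≤ ξ.sharp θ ∧ q < 2 ^ (J + 1) := by
  obtain ⟨φ, p, q, J, hφ, hp, hq, hpJ, hqJ, hgood⟩ := e.exists_short_prf h
  -- The r.e. set is θ = {`selfCons`, `G`}: the first is good at `J` by minimality, the second at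
  -- every scope because it is true.
  have hJ : (J : EReal) ≤ ξ.sharp {e.selfCons, G} := by
    refine le_sSup ⟨J, rfl, ?_⟩
    rintro ψ (rfl | rfl)
    · exact hgood
    · exact hG.realizeScope_of_realize (fun _ _ => ξ.fullyBounded) _ _ _ hGt
  have hu : ({e.selfCons, G} : Set (Fml ξ.L 0)) ∪ ξ.B = insert e.selfCons (insert G ξ.B) := by
    rw [Set.insert_union, Set.singleton_union]
  refine ⟨{e.selfCons, G}, φ, p, q, J, ⟨?_, ξ.isRE_pair _ _ _⟩, hφ, hu ▸ hp, hu ▸ hq,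
    ξ.isShort_of_lt_two_pow hJ hpJ, ξ.isShort_of_lt_two_pow hJ hqJ, hJ, hqJ⟩
  rintro ψ (rfl | rfl)
  · exact e.isPi_selfCons
  · exact hG

theorem holds_selfCons_one (hEA : ξ.EAStable) {G : Fml ξ.L 0} (hG : IsPi ξ.Δ₀ 1 G)
    (hGt : ξ.Holds G) (e : ξ.Encoding 1 (insert G ξ.B)) : ξ.Holds e.selfCons := by
  by_contra h
  obtain ⟨θ, φ, p, q, J, hθ, hφ, hp, hq, hps, hqs, hJ, hqJ⟩ :=
    ξ.exists_short_contradiction hG hGt e h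
  have hφ' := hφ.prenexNeg_one (fun _ _ => ξ.fullyBounded) (fun _ _ => ξ.not_mem)
  refine hφ.not_realizeScope_prenexNeg (fun _ _ => ξ.fullyBounded) ?_ _ _
    (hEA.2 θ hθ φ hφ p hp hps) (hEA.1 θ hθ _ hφ' q hq hqs)
  -- From `q < 2 ^ (J + 1)` the logarithm is strictly below `J + 1`, so its floor is at most `J`.
  have hfl : ⌊Real.logb 2 q⌋ ≤ (J : ℤ) := by
    have : ⌊Real.logb 2 q⌋ < (J : ℤ) + 1 := by
      rw [Int.floor_lt]
      exact_mod_cast logb_lt_of_lt_two_pow hqJ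
    omega
  have hfl' : (⌊Real.logb 2 q⌋ : ℝ) ≤ J := by exact_mod_cast hfl
  -- The scope of the negation is at most `J / 2`, hence at most `♯θ / 2`; the `-1` is slack. The
  -- last comparison stays in `EReal`, where `♯θ` could be infinite.
  calc (((1 / 2 : ℝ) * ⌊Real.logb 2 q⌋ - 1 : ℝ) : EReal) ≤ (((J : ℝ) / 2 : ℝ) : EReal) := by
        rw [EReal.coe_le_coe_iff]; linarith
    _ = (J : EReal) / 2 := by rw [EReal.coe_div]; rfl
    _ ≤ ξ.sharp θ / 2 := EReal.div_le_div_right_of_nonneg (by norm_num) hJ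

theorem holds_selfCons_zero (hst : ξ.EStable ∨ ξ.AStable ∨ ξ.ZeroStable) {G : Fml ξ.L 0}
    (hG : IsPi ξ.Δ₀ 1 G) (hGt : ξ.Holds G) (e : ξ.Encoding 0 (insert G ξ.B)) :
    ξ.Holds e.selfCons := by
  by_contra h
  obtain ⟨θ, φ, p, q, J, hθ, hφ, hp, hq, hps, hqs, -, -⟩ :=
    ξ.exists_short_contradiction hG hGt e h
  have hφ := isPi_zero_iff.1 hφ
  -- A Δ₀ sentence is both Π₁ and Σ₁, with empty blocks of quantifiers, so either of the other
  -- stability notions yields its truth.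
  have hz : ξ.ZeroStable := by
    rcases hst with hE | hA | hz
    · exact fun θ hθ φ hφ p hp hs => ((ξ.fullyBounded hφ).realizeScope _).1
        (hE θ hθ φ (isSigma_one_of_mem hφ) p hp hs)
    · exact fun θ hθ φ hφ p hp hs => ((ξ.fullyBounded hφ).realizeScope _).1
        (hA θ hθ φ (isPi_one_of_mem hφ) p hp hs)
    · exact hz
  rw [(ξ.fullyBounded hφ).prenexNeg_eq] at hq
  exact hz θ hθ _ (ξ.not_mem hφ) q hq hqs (hz θ hθ φ hφ p hp hps)

/-- If `selfCons` is true, adding it to a true finite extension of the base system gives a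
consistent system which recognizes its own consistency. -/
theorem exists_recognizes_of_holds {k : ℕ} {G : Fml ξ.L 0} (hGt : ξ.Holds G)
    (e : ξ.Encoding k (insert G ξ.B)) (h : ξ.Holds e.selfCons) :
    ∃ β : Set (Fml ξ.L 0), ξ.IsFinitizedExtension β ∧ G ∈ β ∧
      ξ.RecognizesLevelConsistency β e ∧ ξ.d.Consistent β ∧ ξ.LevelConsistent k β := by
  -- All axioms hold in ℕ, so by the completeness equivalence all theorems do.
  have hsound : ∀ φ, ξ.d.Provable (insert e.selfCons (insert G ξ.B)) φ → ξ.Holds φ := by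
    intro φ hφ
    refine (ξ.complete _ φ).1 hφ ℕ ?_
    rintro ψ (rfl | rfl | hψ)
    exacts [h, hGt, ξ.B_true ψ hψ]
  refine ⟨insert e.selfCons (insert G ξ.B), ⟨fun φ hφ => .inr (.inr hφ), ?_⟩, .inr (.inl rfl),
    ⟨rfl, (ξ.complete _ _).2 fun M _ _ hM => hM _ (.inl rfl)⟩, ?_, ?_⟩
  · refine (Set.toFinite {e.selfCons, G}).subset ?_
    rintro φ ⟨rfl | rfl | hφ, hφ'⟩
    exacts [.inl rfl, .inr rfl, (hφ' hφ).elim]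
  · rintro φ ⟨h₁, h₂⟩
    exact hsound _ h₂ (hsound _ h₁)
  · rintro φ - ⟨h₁, h₂⟩
    exact (Fml.realize_prenexNeg φ _).1 (hsound _ h₂) (hsound _ h₁)

end GenericConfiguration

theorem mainTheorem6 (ξ : GenericConfiguration) {L' : FirstOrder.Language.{0, 0}} (ι : ξ.L →ᴸ L')
    (D : ProofSystem L') (𝓑 : Set (Fml L' 0)) (h𝓑 : D.IsRE 𝓑)
    (htrue : ∀ φ : Fml ξ.L 0, IsPi ξ.Δ₀ 1 φ → D.Provable 𝓑 (φ.onLHom ι) → ξ.Holds φ)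
    (prf : Fml ξ.L 2) (hprf : ξ.IsPrfFormula ι D 𝓑 prf)
    (check : Fml ξ.L 1) (hcheck : ξ.IsCheckFormula check)
    (testList : ℕ → Fml ξ.L 2) (htest : Set.range testList = ξ.TestFormulas) :
    (ξ.EAStable → ∀ j : ℕ,
      let G := ξ.globSim prf check (testList j)
      Nonempty (ξ.Encoding 1 (insert G ξ.B)) ∧
        ∀ e : ξ.Encoding 1 (insert G ξ.B), ∃ β : Set (Fml ξ.L 0),
          ξ.IsFinitizedExtension β ∧ G ∈ β ∧ ξ.RecognizesLevelConsistency β e ∧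
            ξ.d.Consistent β ∧ ξ.LevelConsistent 1 β) ∧
    (ξ.EStable ∨ ξ.AStable ∨ ξ.ZeroStable → ∀ j : ℕ,
      let G := ξ.globSim prf check (testList j)
      Nonempty (ξ.Encoding 0 (insert G ξ.B)) ∧
        ∀ e : ξ.Encoding 0 (insert G ξ.B), ∃ β : Set (Fml ξ.L 0),
          ξ.IsFinitizedExtension β ∧ G ∈ β ∧ ξ.RecognizesLevelConsistency β e ∧
            ξ.d.Consistent β ∧ ξ.LevelConsistent 0 β) := by
  have htj : ∀ j, testList j ∈ ξ.TestFormulas := fun j => htest ▸ Set.mem_range_self j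
  have hG : ∀ j, IsPi ξ.Δ₀ 1 (ξ.globSim prf check (testList j)) := fun j =>
    ξ.isPi_globSim hprf.1 hcheck.1 (htj j).1
  have hGt : ∀ j, ξ.Holds (ξ.globSim prf check (testList j)) := fun j =>
    ξ.holds_globSim htrue hprf hcheck (htj j)
  exact ⟨fun hst j => ⟨ξ.nonempty_encoding 1 _, fun e =>
      ξ.exists_recognizes_of_holds (hGt j) e (ξ.holds_selfCons_one hst (hG j) (hGt j) e)⟩,
    fun hst j => ⟨ξ.nonempty_encoding 0 _, fun e =>
      ξ.exists_recognizes_of_holds (hGt j) e (ξ.holds_selfCons_zero hst (hG j) (hGt j) e)⟩⟩
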